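/- Let $d\ge 0$ and $k\ge 1$ be integers, let $\mu_d$ be Lebesgue measure on $\mathbb{R}^d$ with the Euclidean metric, and let $D\subset\mathbb{R}^d$ be a non-empty compact set with $D=\overline{D^\circ}$ and $\mu_d(\partial D)=0$. Let $\mathcal F=\{f_1,\dots,f_k\}$ be a family of injective contractions $f_i:\mathbb{R}^d\to\mathbb{R}^d$ (each Lipschitz with some constant $<1$). For $A\subset\mathbb{R}^d$ put $\Phi(A)=\bigcup_{i=1}^k f_i(A)$, and let $E$ be the attractor of $\mathcal F$, i.e. the unique non-empty compact set with $E=\Phi(E)$. Suppose that $f_i(D)\subset D$ for every $i$ (inside family) and that $\mu_d(f_i(D)\cap f_j(D))=0$ for all $i\ne j$ (non-overlapping family). A generator of a dissection of $D$ is a compact set $X\subset\mathbb{R}^d$ with $X=\overline{X^\circ}$ such that $D=X\cup f_1(X)\cup\dots\cup f_k(X)$, $\mu_d(f_i(X)\cap f_j(X))=0$ for all $i\neq j$, and $\mu_d(X\cap f_i(X))=0$ for all $i$. The family $\mathcal F$ admits a dissection of $D$ if a generator exists. Then $\mathcal F$ admits a dissection of $D$ if and only if $\mu_d(E)=0$.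 In that case the generator is unique, and it is $$X = E\cup Y\cup\Phi^2(Y)\cup\Phi^4(Y)\cup\cdots,\qquad Y=\overline{D\setminus\Phi(D)}.$$ -/

import Mathlib

open Set MeasureTheory

open scoped NNReal ENNReal

namespace Dissection

/-- `ℝ^d` with its Euclidean metric and Lebesgue measure `volume`. -/
abbrev Space (d : ℕ) : Type := EuclideanSpace ℝ (Fin d)

/-- `Φ(A) = f₁(A) ∪ ⋯ ∪ f_k(A)`. -/
def Phi {d k : ℕ} (f : Fin k → Space d → Space d) (A : Set (Space d)) : Set (Space d) :=
  ⋃ i, f i '' A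

/-- `X` is a generator of a dissection of `D` with respect to the family `f`. -/
structure IsGenerator {d k : ℕ} (f : Fin k → Space d → Space d) (D X : Set (Space d)) :
    Prop where
  isCompact : IsCompact X
  closure_interior : closure (interior X) = X
  eq_union : D = X ∪ Phi f X
  disjoint_images : ∀ i j, i ≠ j → volume ((f i '' X) ∩ (f j '' X)) = 0
  disjoint_image : ∀ i, volume (X ∩ (f i '' X)) = 0

/-- The family `f` admits a dissection of `D`. -/
def AdmitsDissection {d k : ℕ} (f : Fin k → Space d → Space d) (D : Set (Space d)) : Prop :=
  ∃ X, IsGenerator f D X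

/-- `f` is an inside family with respect to `D`. -/
def IsInsideFamily {d k : ℕ} (f : Fin k → Space d → Space d) (D : Set (Space d)) : Prop :=
  ∀ i, f i '' D ⊆ D

/-- `f` is a non-overlapping family with respect to `D`. -/
def IsNonOverlappingFamily {d k : ℕ} (f : Fin k → Space d → Space d) (D : Set (Space d)) :
    Prop :=
  ∀ i j, i ≠ j → volume ((f i '' D) ∩ (f j '' D)) = 0

/-- `f` is an iterated function system: every `f i` is a contraction, that is, Lipschitz with
some constant `c < 1`. -/
def IsIFS {d k : ℕ} (f : Fin k → Space d → Space d) : Prop :=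
  ∀ i, ∃ c : ℝ≥0, ContractingWith c (f i)

/-- `E` is the attractor of `f`: a non-empty compact set with `E = Φ(E)`. For an iterated function
system with at least one map there is exactly one such set, by `existsUnique_isAttractor`. -/
structure IsAttractor {d k : ℕ} (f : Fin k → Space d → Space d) (E : Set (Space d)) :
    Prop where
  nonempty : E.Nonempty
  isCompact : IsCompact E
  eq_Phi : E = Phi f E

/-- The explicit set `E ∪ Y ∪ Φ²(Y) ∪ Φ⁴(Y) ∪ ⋯` with `Y = closure (D \ Φ(D))`. -/
def explicitGenerator {d k : ℕ} (f : Fin k → Space d → Space d) (D E : Set (Space d)) :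
    Set (Space d) :=
  E ∪ ⋃ n : ℕ, (Phi f)^[2 * n] (closure (D \ Phi f D))

theorem existsUnique_isAttractor {d k : ℕ} (hk : 0 < k) (f : Fin k → Space d → Space d)
    (hf : IsIFS f) : ∃! E, IsAttractor f E := by
  choose c hc using hf
  have : Nonempty (Fin k) := ⟨⟨0, hk⟩⟩
  obtain ⟨m, hm⟩ := Finite.exists_max c
  have hcpt : ∀ A : Set (Space d), IsCompact A → IsCompact (Phi f A) := fun A hA =>
    isCompact_iUnion fun i => hA.image (hc i).2.continuous
  have hne : ∀ A : Set (Space d), A.Nonempty → (Phi f A).Nonempty := fun A hA =>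
    nonempty_iUnion.2 ⟨⟨0, hk⟩, hA.image _⟩
  let T : TopologicalSpace.NonemptyCompacts (Space d) →
      TopologicalSpace.NonemptyCompacts (Space d) := fun A =>
    ⟨⟨Phi f A, hcpt _ A.isCompact⟩, hne _ A.nonempty⟩
  have hT : ContractingWith (c m) T := by
    refine ⟨(hc m).1, fun A B => ?_⟩
    change Metric.hausdorffEDist (Phi f A) (Phi f B) ≤ c m * Metric.hausdorffEDist (A : Set (Space d)) B
    refine (Metric.hausdorffEDist_iUnion_le).trans (iSup_le fun i => ?_)
    have key : ∀ P Q : TopologicalSpace.NonemptyCompacts (Space d),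
        ∀ x ∈ f i '' (P : Set (Space d)), Metric.infEDist x (f i '' (Q : Set (Space d))) ≤
          c m * Metric.hausdorffEDist (P : Set (Space d)) Q := by
      rintro P Q _ ⟨x, hx, rfl⟩
      obtain ⟨y, hy, hxy⟩ := Q.isCompact.exists_infEDist_eq_edist Q.nonempty x
      calc Metric.infEDist (f i x) (f i '' (Q : Set (Space d)))
          ≤ edist (f i x) (f i y) := Metric.infEDist_le_edist_of_mem (mem_image_of_mem _ hy)
        _ ≤ c i * edist x y := (hc i).2 x y
        _ ≤ c m * Metric.hausdorffEDist (P : Set (Space d)) Q := by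
            rw [← hxy]
            gcongr
            · exact hm i
            · exact Metric.infEDist_le_hausdorffEDist_of_mem hx
    refine Metric.hausdorffEDist_le_of_infEDist (key A B) ?_
    rw [Metric.hausdorffEDist_comm]
    exact key B A
  have : Nonempty (TopologicalSpace.NonemptyCompacts (Space d)) :=
    ⟨⟨⟨{0}, isCompact_singleton⟩, singleton_nonempty _⟩⟩
  refine ⟨(hT.fixedPoint T : TopologicalSpace.NonemptyCompacts (Space d)),
    ⟨TopologicalSpace.NonemptyCompacts.nonempty _, TopologicalSpace.NonemptyCompacts.isCompact _,
      ?_⟩, fun K hK => ?_⟩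
  · exact congrArg (fun A : TopologicalSpace.NonemptyCompacts (Space d) => (A : Set (Space d)))
      hT.fixedPoint_isFixedPt.eq.symm
  · have h : Function.IsFixedPt T ⟨⟨K, hK.isCompact⟩, hK.nonempty⟩ :=
      TopologicalSpace.NonemptyCompacts.ext hK.eq_Phi.symm
    exact congrArg (fun A : TopologicalSpace.NonemptyCompacts (Space d) => (A : Set (Space d)))
      (hT.fixedPoint_unique h)

end Dissection

/-! Write S for `explicitGenerator f D E`. Iterating D ⊆ Y ∪ Φ(D) places each point of D in some
layer Φⁿ(Y) or in ⋂ Φⁿ(D) ⊆ E. The even layers and E make up S, the odd layers lie in Φ(S), and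
distinct layers overlap in null sets; so S is a generator once E is null.

Conversely, for a generator X the set Φ²(X) lies in D = X ∪ Φ(X) and meets Φ(X) in a null set,
whence Φ²(X) ⊆ X (`IsGenerator.Phi_Phi_subset`). Contraction then gives E ⊆ X, so E = E ∩ Φ(E) ⊆ X ∩
Φ(X) is null. Likewise S ⊆ X, and the open set X° \ S lies in X ∩ Φ(X), so it is empty and X = S.

Such arguments need each f_i to carry interiors to open sets. This is invariance of domain for
injective Lipschitz maps (`LipschitzWith.isOpenMap_of_injective`), deduced from
`no_lipschitz_retraction` by way of `exists_eq_zero_of_close_to_id`. -/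

namespace Dissection

/-! ### No Lipschitz retraction of a ball onto its sphere -/

open Polynomial in
/-- Polynomials of degree at most `n` can be extrapolated from `[0, δ]` to `1`. -/
theorem exists_extrapolation (n : ℕ) {δ : ℝ} (hδ : 0 < δ) :
    ∃ t c : ℕ → ℝ, (∀ i ≤ n, t i ∈ Icc 0 δ) ∧ ∀ p : ℝ[X], p.natDegree ≤ n →
      p.eval 1 = ∑ i ∈ Finset.range (n + 1), c i * p.eval (t i) := by
  -- Dividing by `n + 1` rather than `n` keeps the step nonzero when `n = 0`.
  set t : ℕ → ℝ := fun i => δ / (n + 1) * i with ht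
  refine ⟨t, fun i => (Lagrange.basis (Finset.range (n + 1)) t i).eval 1, fun i hi => ⟨by
    simp only [ht]; positivity, ?_⟩, fun p hp => ?_⟩
  · have : (i : ℝ) ≤ n + 1 := by exact_mod_cast hi.trans n.le_succ
    calc δ / (n + 1) * i ≤ δ / (n + 1) * (n + 1) := by gcongr
      _ = δ := by field_simp
  · have hinj : InjOn t (Finset.range (n + 1)) := by
      intro i _ j _ hij
      have h0 : δ / (n + 1) ≠ 0 := by positivity
      exact_mod_cast mul_left_cancel₀ h0 hij
    have hdeg : p.degree < (Finset.range (n + 1)).card := by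
      rw [Finset.card_range]
      exact (degree_le_natDegree).trans_lt (by exact_mod_cast Nat.lt_succ_of_le hp)
    conv_lhs => rw [Lagrange.eq_interpolate hinj hdeg]
    simp [Lagrange.interpolate_apply, eval_finsetSum, mul_comm]

section

variable {V : Type*} [NormedAddCommGroup V] [InnerProductSpace ℝ V] [FiniteDimensional ℝ V]

open Polynomial in
/-- `t ↦ det (1 + t A)` is a polynomial of degree at most the dimension. -/
theorem exists_polynomial_eval_eq_det (A : V →L[ℝ] V) :
    ∃ p : ℝ[X], p.natDegree ≤ Module.finrank ℝ V ∧
      ∀ t : ℝ, p.eval t = (ContinuousLinearMap.id ℝ V + t • A).det := by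
  let b := Module.finBasis ℝ V
  let M := LinearMap.toMatrix b b A
  refine ⟨((X : ℝ[X]) • M.map C + (1 : Matrix _ _ ℝ).map C).det, ?_, fun t => ?_⟩
  · exact (natDegree_det_X_add_C_le M 1).trans (by simp)
  · have h : (ContinuousLinearMap.id ℝ V + t • A).det = (1 + t • M).det := by
      rw [ContinuousLinearMap.det, ← LinearMap.det_toMatrix b]
      simp [M, map_add, map_smul]
    rw [h, ← coe_evalRingHom, RingHom.map_det]
    congr 1
    ext i j
    by_cases hij : i = j <;> simp [hij, add_comm] <;> ring

/-- A small Lipschitz perturbation of the identity that is trivial outside a ball permutes it. -/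
theorem image_ball_add_smul {R : ℝ} {K : ℝ≥0} {h : V → V} (hh : LipschitzWith K h)
    (h0 : ∀ x, R ≤ ‖x‖ → h x = 0) {t : ℝ} (ht : |t| * K < 1) :
    Function.Injective (fun x => x + t • h x) ∧
      (fun x => x + t • h x) '' Metric.ball 0 R = Metric.ball 0 R := by
  set g : V → V := fun x => x + t • h x with hg
  have hA : ApproximatesLinearOn g ((ContinuousLinearEquiv.refl ℝ V : V ≃L[ℝ] V) : V →L[ℝ] V)
      univ (‖t‖₊ * K) := by
    intro x _ y _
    have : g x - g y - ((ContinuousLinearEquiv.refl ℝ V : V ≃L[ℝ] V) : V →L[ℝ] V) (x - y)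
        = t • (h x - h y) := by
      simp [hg, smul_sub]; abel
    rw [this, norm_smul]
    push_cast
    rw [mul_assoc]
    gcongr
    simpa [dist_eq_norm] using hh.dist_le_mul x y
  have hc : Subsingleton V ∨ ‖t‖₊ * K < ‖((ContinuousLinearEquiv.refl ℝ V).symm : V →L[ℝ] V)‖₊⁻¹ := by
    rcases subsingleton_or_nontrivial V with hV | hV
    · exact Or.inl hV
    · right
      have : ‖((ContinuousLinearEquiv.refl ℝ V).symm : V →L[ℝ] V)‖₊ = 1 := by
        ext; exact ContinuousLinearMap.norm_id
      rw [this, inv_one, ← NNReal.coe_lt_coe]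
      simpa using ht
  have hinj : Function.Injective g := injOn_univ.1 (hA.injOn hc)
  have hsurj : Function.Surjective g := hA.surjective hc
  have hout : ∀ x, R ≤ ‖x‖ → g x = x := fun x hx => by simp [hg, h0 x hx]
  refine ⟨hinj, Subset.antisymm ?_ ?_⟩
  · rintro _ ⟨x, hx, rfl⟩
    rw [mem_ball_zero_iff] at hx ⊢
    by_contra! hcon
    have := hinj (hout _ hcon)
    rw [this] at hcon
    linarith
  · intro y hy
    obtain ⟨x, rfl⟩ := hsurj y
    refine ⟨x, ?_, rfl⟩
    rw [mem_ball_zero_iff] at hy ⊢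
    by_contra! hcon
    rw [hout x hcon] at hy
    linarith

variable [MeasurableSpace V] [BorelSpace V]

/-- Lipschitz maps of a finite dimensional space send null sets to null sets. -/
theorem _root_.LipschitzOnWith.volume_image_eq_zero {K : ℝ≥0} {f : V → V} {s : Set V}
    (hf : LipschitzOnWith K f s) (hs : volume s = 0) : volume (f '' s) = 0 := by
  have h1 : (volume : Measure V) ≪ μH[Module.finrank ℝ V] :=
    Measure.absolutelyContinuous_isAddHaarMeasure _ _
  have h2 : μH[Module.finrank ℝ V] ≪ (volume : Measure V) :=
    Measure.absolutelyContinuous_isAddHaarMeasure _ _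
  refine h1 (le_antisymm ((hf.hausdorffMeasure_image_le (by positivity)).trans ?_) zero_le)
  simp [h2 hs]

/-- There is no Lipschitz retraction of a ball onto its sphere. -/
theorem no_lipschitz_retraction {R : ℝ} (hR : 0 < R) {K : ℝ≥0} {h : V → V}
    (hh : LipschitzWith K h) (h0 : ∀ x, R ≤ ‖x‖ → h x = 0)
    (hS : ∀ x, ‖x‖ ≤ R → ‖x + h x‖ = R) : False := by
  let B : Set V := Metric.ball 0 R
  let S : Set V := B ∩ {x | DifferentiableAt ℝ h x}
  have hSm : MeasurableSet S := measurableSet_ball.inter (measurableSet_of_differentiableAt ℝ h)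
  -- Rademacher's theorem: `h` is differentiable almost everywhere.
  have hnull : volume (B \ S) = 0 := by
    refine measure_mono_null (fun x hx => ?_) (ae_iff.1 hh.ae_differentiableAt)
    exact fun hd => hx.2 ⟨hx.1, hd⟩
  have hSB : S ⊆ B := inter_subset_left
  let q : ℝ → V → ℝ := fun t x => (ContinuousLinearMap.id ℝ V + t • fderiv ℝ h x).det
  have hqm : ∀ t, Measurable (q t) := fun t =>
    ContinuousLinearMap.continuous_det.measurable.comp
      (measurable_const.add ((measurable_fderiv ℝ h).const_smul t))
  obtain ⟨ε, hε, hdet⟩ : ∃ ε > 0, ∀ A : V →L[ℝ] V, ‖A - ContinuousLinearMap.id ℝ V‖ < ε →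
      0 < A.det := by
    have h1 : ∀ᶠ A in nhds (ContinuousLinearMap.id ℝ V), 0 < A.det :=
      (ContinuousLinearMap.continuous_det (𝕜 := ℝ) (E := V)).continuousAt.eventually_const_lt
        (by simp [ContinuousLinearMap.det])
    obtain ⟨ε, hε, h2⟩ := Metric.eventually_nhds_iff.1 h1
    exact ⟨ε, hε, fun A hA => h2 (by rwa [dist_eq_norm])⟩
  have hK1 : (0 : ℝ) < K + 1 := by positivity
  -- For `t ≤ δ` the bound 1 makes `x + t • h x` a bijection of the ball, and the bound `ε` makes
  -- its Jacobian positive.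
  set δ : ℝ := min ε 1 / (2 * (K + 1)) with hδdef
  have hδ : 0 < δ := by positivity
  have hδK : δ * K < min ε 1 := by
    have : δ * (K + 1) = min ε 1 / 2 := by rw [hδdef]; field_simp
    have h3 : 0 < min ε 1 := by positivity
    nlinarith
  have hint : ∀ t ∈ Icc 0 δ, IntegrableOn (q t) S ∧ ∫ x in S, q t x = volume.real B := by
    intro t ht
    have htK : |t| * K < min ε 1 := by
      rw [abs_of_nonneg ht.1]
      exact (mul_le_mul_of_nonneg_right ht.2 K.2).trans_lt hδK
    obtain ⟨hinj, himg⟩ := image_ball_add_smul hh h0 (htK.trans_le (min_le_right _ _))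
    have hpos : ∀ x, 0 < q t x := fun x => hdet _ <| by
      rw [add_sub_cancel_left, norm_smul]
      refine lt_of_le_of_lt ?_ (htK.trans_le (min_le_left _ _))
      rw [Real.norm_eq_abs]
      gcongr
      exact norm_fderiv_le_of_lipschitz ℝ hh
    have hder : ∀ x ∈ S, HasFDerivWithinAt (fun x => x + t • h x)
        (ContinuousLinearMap.id ℝ V + t • fderiv ℝ h x) S x := fun x hx =>
      ((hasFDerivAt_id x).add (hx.2.hasFDerivAt.const_smul t)).hasFDerivWithinAt
    have hcv := lintegral_abs_det_fderiv_eq_addHaar_image volume hSm hder hinj.injOn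
    have hgl : LipschitzWith (1 + ‖t‖₊ * K) (fun x => x + t • h x) := by
      refine LipschitzWith.id.add (LipschitzWith.of_dist_le_mul fun x y => ?_)
      rw [dist_smul₀]
      push_cast
      rw [mul_assoc]
      gcongr
      exact hh.dist_le_mul x y
    have hvol : volume ((fun x => x + t • h x) '' S) = volume B := by
      refine le_antisymm (measure_mono ((image_mono hSB).trans himg.le)) ?_
      have hsub : B ⊆ ((fun x => x + t • h x) '' S) ∪ ((fun x => x + t • h x) '' (B \ S)) := by
        rw [← image_union, union_sdiff_cancel hSB]
        exact himg.ge
      refine (measure_mono hsub).trans ((measure_union_le _ _).trans ?_)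
      rw [(hgl.lipschitzOnWith (s := B \ S)).volume_image_eq_zero hnull, add_zero]
    rw [hvol] at hcv
    have habs : ∀ x, ENNReal.ofReal |q t x| = ENNReal.ofReal (q t x) := fun x => by
      rw [abs_of_pos (hpos x)]
    have hcv' : ∫⁻ x in S, ENNReal.ofReal (q t x) = volume B := by
      rw [← hcv]
      exact lintegral_congr fun x => (habs x).symm
    constructor
    · refine ⟨(hqm t).aestronglyMeasurable, ?_⟩
      rw [hasFiniteIntegral_iff_ofReal (Filter.Eventually.of_forall fun x => (hpos x).le), hcv']
      exact measure_ball_lt_top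
    · rw [integral_eq_lintegral_of_nonneg_ae (Filter.Eventually.of_forall fun x => (hpos x).le)
        (hqm t).aestronglyMeasurable, hcv', Measure.real]
  -- The nodes and weights do not depend on `x`, so the integral of the Jacobian, constant on `[0,
  -- δ]`, keeps its value at `t = 1`.
  obtain ⟨t, c, ht, htc⟩ := exists_extrapolation (Module.finrank ℝ V) hδ
  have hq1 : ∀ x, q 1 x = ∑ i ∈ Finset.range (Module.finrank ℝ V + 1), c i * q (t i) x := by
    intro x
    obtain ⟨p, hp, hpq⟩ := exists_polynomial_eval_eq_det (fderiv ℝ h x)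
    have := htc p hp
    simpa only [hpq] using this
  have hsum : ∑ i ∈ Finset.range (Module.finrank ℝ V + 1), c i = 1 := by
    simpa using (htc 1 (by simp)).symm
  have htmem : ∀ i ∈ Finset.range (Module.finrank ℝ V + 1), t i ∈ Icc 0 δ := fun i hi =>
    ht i (Nat.lt_succ_iff.1 (Finset.mem_range.1 hi))
  have hI : ∫ x in S, q 1 x = volume.real B := by
    simp only [hq1]
    rw [integral_finsetSum _ fun i hi => ((hint _ (htmem i hi)).1.const_mul _)]
    simp only [integral_const_mul]
    rw [Finset.sum_congr rfl fun i hi => by rw [(hint _ (htmem i hi)).2], ← Finset.sum_mul, hsum,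
      one_mul]
  -- At `t = 1` the image lies on the sphere, so the derivative maps into the orthogonal complement
  -- of the nonzero vector `x + h x` and is singular.
  have hzero : ∀ x ∈ S, q 1 x = 0 := by
    intro x hx
    have hxR : ‖x‖ < R := mem_ball_zero_iff.1 hx.1
    set A : V →L[ℝ] V := ContinuousLinearMap.id ℝ V + (1 : ℝ) • fderiv ℝ h x with hA
    have hd : HasFDerivAt (fun y => y + h y) A x := by
      rw [hA, one_smul]
      exact (hasFDerivAt_id x).add hx.2.hasFDerivAt
    have hn : HasFDerivAt (fun y => ‖y + h y‖ ^ 2) (0 : V →L[ℝ] ℝ) x := by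
      refine (hasFDerivAt_const (R ^ 2) x).congr_of_eventuallyEq ?_
      filter_upwards [Metric.isOpen_ball.mem_nhds hx.1] with y hy
      rw [hS y (mem_ball_zero_iff.1 hy).le]
    have horth : ∀ v, inner ℝ (x + h x) (A v) = 0 := fun v => by
      have := congrArg (fun T : V →L[ℝ] ℝ => T v) (hd.norm_sq.unique hn)
      have h2 : 2 * inner ℝ (x + h x) (A v) = 0 := by simpa [inner_add_left, mul_add] using this
      linarith
    by_contra hne
    have hu : IsUnit (LinearMap.det (A : V →ₗ[ℝ] V)) := isUnit_iff_ne_zero.2 hne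
    obtain ⟨v, hv⟩ : ∃ v, A v = x + h x :=
      (LinearMap.range_eq_top.1 ((LinearMap.isUnit_iff_range_eq_top _).1
        ((LinearMap.isUnit_iff_isUnit_det _).2 hu))) _
    have h1 := horth v
    rw [hv, inner_self_eq_zero] at h1
    have h2 := hS x hxR.le
    rw [h1, norm_zero] at h2
    exact hR.ne h2
  rw [setIntegral_congr_fun hSm hzero] at hI
  simp only [integral_zero] at hI
  have : 0 < volume.real B := ENNReal.toReal_pos (Metric.measure_ball_pos _ _ hR).ne'
    measure_ball_lt_top.ne
  linarith

end

end Dissection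

namespace Dissection

/-! ### Calculus of locally Lipschitz maps -/

section LocallyLipschitz

variable {X V : Type*} [PseudoMetricSpace X] [NormedAddCommGroup V]

theorem _root_.LocallyLipschitz.add_vec {u v : X → V} (hu : LocallyLipschitz u)
    (hv : LocallyLipschitz v) : LocallyLipschitz fun x => u x + v x := by
  have h : LipschitzWith 2 (fun p : V × V => p.1 + p.2) := by
    rw [← one_add_one_eq_two]
    exact LipschitzWith.prod_fst.add LipschitzWith.prod_snd
  exact h.locallyLipschitz.comp (hu.prodMk hv)

theorem _root_.LocallyLipschitz.neg_vec {u : X → V} (hu : LocallyLipschitz u) :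
    LocallyLipschitz fun x => -u x :=
  (LipschitzWith.id.neg (E := V)).locallyLipschitz.comp hu

theorem _root_.LocallyLipschitz.sub_vec {u v : X → V} (hu : LocallyLipschitz u)
    (hv : LocallyLipschitz v) : LocallyLipschitz fun x => u x - v x := by
  simpa only [sub_eq_add_neg] using hu.add_vec hv.neg_vec

theorem _root_.LocallyLipschitz.norm_vec {u : X → V} (hu : LocallyLipschitz u) :
    LocallyLipschitz fun x => ‖u x‖ :=
  (lipschitzWith_one_norm (E := V)).locallyLipschitz.comp hu

theorem _root_.LocallyLipschitz.const_max_real {a : X → ℝ} (ha : LocallyLipschitz a) (m : ℝ) :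
    LocallyLipschitz fun x => max m (a x) :=
  (LipschitzWith.id.const_max m).locallyLipschitz.comp ha

/-- Truncation keeps the inverse away from its pole, so radial projections can be written as
globally defined locally Lipschitz maps. -/
theorem _root_.LocallyLipschitz.inv_max {a : X → ℝ} (ha : LocallyLipschitz a) {m : ℝ}
    (hm : 0 < m) : LocallyLipschitz fun x => (max m (a x))⁻¹ := by
  have h : LipschitzWith (Real.toNNReal ((m * m)⁻¹)) fun s : ℝ => (max m s)⁻¹ := by
    refine LipschitzWith.of_dist_le_mul fun s t => ?_
    have hs : 0 < max m s := lt_max_of_lt_left hm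
    have ht : 0 < max m t := lt_max_of_lt_left hm
    have h1 : dist (max m s) (max m t) ≤ dist s t := by
      simpa using (LipschitzWith.id.const_max m).dist_le_mul s t
    rw [Real.coe_toNNReal _ (by positivity), dist_inv_inv₀ hs.ne' ht.ne', div_eq_inv_mul]
    gcongr
    · rw [Real.norm_of_nonneg hs.le]; exact le_max_left _ _
    · rw [Real.norm_of_nonneg ht.le]; exact le_max_left _ _
  exact h.locallyLipschitz.comp ha

variable [NormedSpace ℝ V]

theorem _root_.LocallyLipschitz.smul_vec {a : X → ℝ} {u : X → V} (ha : LocallyLipschitz a)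
    (hu : LocallyLipschitz u) : LocallyLipschitz fun x => a x • u x :=
  (ContDiff.locallyLipschitz (𝕂 := ℝ) (contDiff_smul (𝕜 := ℝ) (F := V))).comp (ha.prodMk hu)

variable [FiniteDimensional ℝ V]

/-- A locally Lipschitz map that vanishes outside a ball is Lipschitz. -/
theorem _root_.LocallyLipschitz.exists_lipschitzWith {u : V → V} (hu : LocallyLipschitz u)
    {R : ℝ} (hR : 0 < R) (h0 : ∀ x, R ≤ ‖x‖ → u x = 0) : ∃ K, LipschitzWith K u := by
  have : ProperSpace V := FiniteDimensional.proper ℝ V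
  obtain ⟨K, hK⟩ := LocallyLipschitzOn.exists_lipschitzOnWith_of_compact
    (isCompact_closedBall (0 : V) (2 * R)) (hu.locallyLipschitzOn)
  obtain ⟨M, hM⟩ := (isCompact_closedBall (0 : V) R).exists_bound_of_continuousOn
    hu.continuous.continuousOn
  have hM0 : 0 ≤ M := (norm_nonneg _).trans (hM 0 (by simp [hR.le]))
  have key : ∀ x y, ‖x‖ ≤ R → dist (u x) (u y) ≤ (K + M / R) * dist x y := by
    intro x y hx
    have hMR : 0 ≤ M / R * dist x y := by positivity
    by_cases hy : ‖y‖ ≤ 2 * R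
    · have := hK.dist_le_mul x (by simp; linarith) y (by simpa using hy)
      linarith
    · push Not at hy
      have h1 : R ≤ dist x y := by
        have := norm_sub_norm_le y x
        rw [dist_comm, dist_eq_norm]
        linarith
      rw [h0 y (by linarith), dist_zero_right]
      have h2 : M ≤ M / R * dist x y := by
        calc M = M / R * R := by field_simp
          _ ≤ _ := by gcongr
      have h3 : 0 ≤ (K : ℝ) * dist x y := by positivity
      linarith [hM x (by simpa using hx)]
  refine ⟨K + Real.toNNReal (M / R), LipschitzWith.of_dist_le_mul fun x y => ?_⟩
  push_cast
  rw [Real.coe_toNNReal _ (by positivity)]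
  rcases le_total ‖x‖ R with hx | hx
  · exact key x y hx
  · rcases le_total ‖y‖ R with hy | hy
    · rw [dist_comm, dist_comm x]; exact key y x hy
    · rw [h0 x hx, h0 y hy, dist_self]; positivity

end LocallyLipschitz

/-! ### Invariance of domain -/

section

variable {V : Type*} [NormedAddCommGroup V] [InnerProductSpace ℝ V] [FiniteDimensional ℝ V]

/-- A locally Lipschitz map close to the identity on the unit ball has a zero there. -/
theorem exists_eq_zero_of_close_to_id {H : V → V} (hH : LocallyLipschitz H)
    (hclose : ∀ x, ‖x‖ ≤ 1 → ‖H x - x‖ ≤ 1 / 2) : ∃ x, ‖x‖ ≤ 1 ∧ H x = 0 := by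
  by_contra! hne
  let _ : MeasurableSpace V := borel V
  have _ : BorelSpace V := ⟨rfl⟩
  have hid : LocallyLipschitz (fun x : V => x) := LocallyLipschitz.id
  let ρ : V → V := fun x => (max 1 ‖x‖)⁻¹ • x
  have hρ : LocallyLipschitz ρ := (hid.norm_vec.inv_max one_pos).smul_vec hid
  have hρ1 : ∀ x, ‖ρ x‖ ≤ 1 := fun x => by
    have h1 : 0 < max 1 ‖x‖ := lt_max_of_lt_left one_pos
    rw [norm_smul, norm_inv, Real.norm_of_nonneg h1.le, inv_mul_le_iff₀ h1, mul_one]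
    exact le_max_right _ _
  have hρid : ∀ x, ‖x‖ ≤ 1 → ρ x = x := fun x hx => by simp [ρ, max_eq_left hx]
  let χ : V → ℝ := fun x => max 0 (-max (-1) (‖x‖ - 2))
  have hχ : LocallyLipschitz χ :=
    ((((hid.norm_vec).sub_vec (LocallyLipschitz.const 2)).const_max_real _).neg_vec).const_max_real _
  -- Since `ρ` retracts onto the unit ball and `χ` falls from 1 to 0 between radii 1 and 2, `ψ` is
  -- `H` on the unit ball and the identity beyond radius 2. In between, the added term has norm at
  -- most 1/2 < `‖x‖`.
  let ψ : V → V := fun x => x + χ x • (H (ρ x) - ρ x)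
  have hψ : LocallyLipschitz ψ :=
    hid.add_vec (hχ.smul_vec ((hH.comp hρ).sub_vec hρ))
  have hχout : ∀ x, 2 ≤ ‖x‖ → χ x = 0 := fun x hx =>
    max_eq_left (by linarith [le_max_right (-1) (‖x‖ - 2)])
  have hχin : ∀ x, ‖x‖ ≤ 1 → χ x = 1 := fun x hx => by
    simp only [χ]
    rw [max_eq_left (show ‖x‖ - 2 ≤ -1 by linarith)]
    norm_num
  have hχ01 : ∀ x, 0 ≤ χ x ∧ χ x ≤ 1 := fun x =>
    ⟨le_max_left _ _, max_le zero_le_one (by linarith [le_max_left (-1) (‖x‖ - 2)])⟩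
  have hψ0 : ∀ x, ψ x ≠ 0 := by
    intro x hx
    rcases le_or_gt ‖x‖ 1 with h1 | h1
    · refine hne x h1 ?_
      simpa [ψ, hχin x h1, hρid x h1] using hx
    · have h2 : ‖x‖ = χ x * ‖H (ρ x) - ρ x‖ := by
        have := congrArg norm (eq_neg_of_add_eq_zero_left hx)
        rwa [norm_neg, norm_smul, Real.norm_of_nonneg (hχ01 x).1] at this
      have h3 := hclose _ (hρ1 x)
      nlinarith [hχ01 x, norm_nonneg (H (ρ x) - ρ x)]
  obtain ⟨m, hm, hmψ⟩ : ∃ m > 0, ∀ x, ‖x‖ ≤ 2 → m ≤ ‖ψ x‖ := by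
    obtain ⟨x, -, hx⟩ := (isCompact_closedBall (0 : V) 2).exists_isMinOn
      ⟨0, by simp⟩ hψ.continuous.norm.continuousOn
    exact ⟨‖ψ x‖, norm_pos_iff.2 (hψ0 x), fun y hy => hx (by simpa using hy)⟩
  have hψout : ∀ x, 2 ≤ ‖x‖ → ψ x = x := fun x hx => by simp [ψ, hχout x hx]
  let m' := min m 2
  have hm' : 0 < m' := lt_min hm two_pos
  have hmψ' : ∀ x, max m' ‖ψ x‖ = ‖ψ x‖ := fun x => max_eq_right <| by
    rcases le_total ‖x‖ 2 with h | h
    · exact (min_le_left _ _).trans (hmψ x h)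
    · rw [hψout x h]; exact (min_le_right _ _).trans h
  -- Here `x + h x` is `ψ x` rescaled to norm `max 2 ‖x‖`: a retraction onto the sphere of radius 2.
  -- The truncation at `m'` never changes a value.
  let h : V → V := fun x => (max 2 ‖x‖ * (max m' ‖ψ x‖)⁻¹) • ψ x - x
  have hh : LocallyLipschitz h :=
    (((hid.norm_vec.const_max_real 2).smul_vec (hψ.norm_vec.inv_max hm')).smul_vec hψ).sub_vec hid
  have h0 : ∀ x, 2 ≤ ‖x‖ → h x = 0 := fun x hx => by
    have : ‖x‖ ≠ 0 := by linarith
    simp only [h, hmψ', hψout x hx, max_eq_right hx]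
    rw [mul_inv_cancel₀ this, one_smul, sub_self]
  obtain ⟨K, hK⟩ := hh.exists_lipschitzWith two_pos h0
  refine no_lipschitz_retraction two_pos hK h0 fun x hx => ?_
  have : ‖ψ x‖ ≠ 0 := norm_ne_zero_iff.2 (hψ0 x)
  simp only [h, hmψ', max_eq_left hx, add_sub_cancel]
  rw [norm_smul, norm_mul, norm_inv, norm_norm, Real.norm_of_nonneg two_pos.le]
  field_simp

/-- Invariance of domain at a point, for injective locally Lipschitz maps. -/
theorem image_closedBall_mem_nhds {f : V → V} (hf : LocallyLipschitz f)
    (hinj : Function.Injective f) : f '' Metric.closedBall 0 1 ∈ nhds (f 0) := by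
  by_contra hnot
  let _ : MeasurableSpace V := borel V
  have _ : BorelSpace V := ⟨rfl⟩
  let B : Set V := Metric.closedBall 0 1
  have hB : IsCompact B := isCompact_closedBall 0 1
  have : CompactSpace B := isCompact_iff_compactSpace.1 hB
  have he : Topology.IsClosedEmbedding (fun x : B => f x) :=
    (hf.continuous.comp continuous_subtype_val).isClosedEmbedding
      (hinj.comp Subtype.val_injective)
  -- Tietze extends the inverse of `f` on the ball to `G`. The plan is to smooth `G` to `P`, push `f
  -- '' B` off a small ball around a missed point `c`, and obtain a map near the identity that has
  -- no zero.
  obtain ⟨G, hG⟩ := ContinuousMap.exists_extension' he ⟨fun x : B => (x : V), continuous_subtype_val⟩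
  have hGf : ∀ x, ‖x‖ ≤ 1 → G (f x) = x := fun x hx =>
    congrFun hG ⟨x, by simpa [B] using hx⟩
  -- The radius `2 * ε` covers the sphere of radius `ε` about `c`, as `‖c - f 0‖ < ε`.
  obtain ⟨ε, hε, hGε⟩ : ∃ ε > 0, ∀ y, ‖y - f 0‖ ≤ 2 * ε → ‖G y‖ ≤ 1 / 10 := by
    have h1 : ∀ᶠ y in nhds (f 0), ‖G y‖ < 1 / 10 := by
      refine (G.continuous.norm.continuousAt).eventually_lt_const ?_
      simp [hGf 0 (by simp)]
    obtain ⟨r, hr, h2⟩ := Metric.eventually_nhds_iff.1 h1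
    refine ⟨r / 4, by positivity, fun y hy => (h2 ?_).le⟩
    rw [dist_eq_norm]; linarith
  have hK : IsCompact (f '' B) := hB.image hf.continuous
  obtain ⟨c, hcε, hcK⟩ : ∃ c, ‖c - f 0‖ < ε ∧ c ∉ f '' B := by
    by_contra! hall
    exact hnot (Metric.mem_nhds_iff.2 ⟨ε, hε, fun c hc => hall c (by simpa [dist_eq_norm] using hc)⟩)
  obtain ⟨η, hη, hηK⟩ : ∃ η > 0, ∀ x, ‖x‖ ≤ 1 → η ≤ ‖f x - c‖ := by
    obtain ⟨x, hx, hmin⟩ := hB.exists_isMinOn ⟨0, by simp [B]⟩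
      (hf.continuous.sub continuous_const).norm.continuousOn (f := fun x => ‖f x - c‖)
    refine ⟨‖f x - c‖, norm_pos_iff.2 fun h => hcK ⟨x, hx, sub_eq_zero.1 h⟩, fun y hy => hmin ?_⟩
    simpa [B] using hy
  obtain ⟨δ, hδ, hδ10, hδG⟩ : ∃ δ > 0, δ ≤ 1 / 10 ∧
      ∀ x, ‖x‖ ≤ 1 → ε ≤ ‖f x - c‖ → δ ≤ ‖x‖ := by
    have hcl : IsClosed {x : V | ε ≤ ‖f x - c‖} :=
      isClosed_le continuous_const (hf.continuous.sub continuous_const).norm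
    have h0 : {x : V | ε ≤ ‖f x - c‖}ᶜ ∈ nhds (0 : V) :=
      hcl.isOpen_compl.mem_nhds (by
        simp only [mem_compl_iff, mem_ofPred_eq, not_le]
        rwa [norm_sub_rev])
    obtain ⟨r, hr, h2⟩ := Metric.mem_nhds_iff.1 h0
    refine ⟨min r (1 / 10), by positivity, min_le_right _ _, fun x _ hx2 => ?_⟩
    by_contra! hlt
    exact h2 (mem_ball_zero_iff.2 (hlt.trans_le (min_le_left _ _))) hx2
  obtain ⟨P, hP, hPG, -⟩ := G.continuous.exists_contDiff_approx 1
    (continuous_const (y := δ / 4)) (fun _ => by positivity)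
  -- A differentiable map sends the null sphere to a null set, so a small translation makes `P - v`
  -- nonzero there.
  obtain ⟨v, hvδ, hv⟩ : ∃ v, ‖v‖ < δ / 4 ∧ v ∉ P '' Metric.sphere c ε := by
    have hnull : volume (P '' Metric.sphere c ε) = 0 :=
      addHaar_image_eq_zero_of_differentiableOn_of_addHaar_eq_zero volume
        (hP.differentiable (by norm_num)).differentiableOn
        (Measure.addHaar_sphere_of_ne_zero volume c hε.ne')
    by_contra! hall
    refine (Metric.measure_ball_pos volume (0 : V) (by positivity : 0 < δ / 4)).ne'
      (measure_mono_null (fun v hv => hall v (mem_ball_zero_iff.1 hv)) hnull)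
  -- On `f '' B`, which stays at distance `η` from `c`, this projects the part within `ε` of `c`
  -- radially onto the sphere and fixes the rest.
  let Φ : V → V := fun y => c + (max ε ‖y - c‖ * (max η ‖y - c‖)⁻¹) • (y - c)
  have hid : LocallyLipschitz (fun x : V => x) := LocallyLipschitz.id
  have hsub : LocallyLipschitz (fun y : V => y - c) := hid.sub_vec (LocallyLipschitz.const c)
  have hΦ : LocallyLipschitz Φ := (LocallyLipschitz.const c).add_vec
    (((hsub.norm_vec.const_max_real ε).smul_vec (hsub.norm_vec.inv_max hη)).smul_vec hsub)
  have hPl : LocallyLipschitz P := ContDiff.locallyLipschitz (𝕂 := ℝ) hP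
  have hH : LocallyLipschitz (fun x => P (Φ (f x)) - v) :=
    (hPl.comp (hΦ.comp hf)).sub_vec (LocallyLipschitz.const v)
  have hPv : ∀ y, ‖P y - v - G y‖ ≤ δ / 2 := fun y => by
    have h1 := hPG y
    rw [dist_eq_norm] at h1
    have h2 : P y - v - G y = (P y - G y) - v := by abel
    rw [h2]
    linarith [norm_sub_le (P y - G y) v]
  have hfar : ∀ x, ‖x‖ ≤ 1 → ε ≤ ‖f x - c‖ → Φ (f x) = f x := fun x hx hx2 => by
    have h1 := hηK x hx
    have h2 : ‖f x - c‖ ≠ 0 := by linarith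
    simp only [Φ, max_eq_right hx2, max_eq_right h1]
    rw [mul_inv_cancel₀ h2, one_smul, add_sub_cancel]
  have hnear : ∀ x, ‖x‖ ≤ 1 → ‖f x - c‖ < ε → Φ (f x) ∈ Metric.sphere c ε := fun x hx hx2 => by
    have h1 := hηK x hx
    have h2 : ‖f x - c‖ ≠ 0 := by linarith
    rw [mem_sphere_iff_norm]
    simp only [Φ, max_eq_left hx2.le, max_eq_right h1, add_sub_cancel_left]
    rw [norm_smul, norm_mul, norm_inv, norm_norm, Real.norm_of_nonneg hε.le]
    field_simp
  obtain ⟨x, hx, hx0⟩ := exists_eq_zero_of_close_to_id hH fun x hx => by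
    rcases le_or_gt ε ‖f x - c‖ with h | h
    · simp only [hfar x hx h]
      have := hPv (f x)
      rw [hGf x hx] at this
      linarith
    · have h1 : ‖x‖ ≤ 1 / 10 := by
        have := hGε (f x) (by
          have := norm_sub_le_norm_sub_add_norm_sub (f x) c (f 0)
          linarith)
        rwa [hGf x hx] at this
      have h2 : ‖G (Φ (f x))‖ ≤ 1 / 10 := hGε _ (by
        have h3 := hnear x hx h
        rw [mem_sphere_iff_norm] at h3
        have := norm_sub_le_norm_sub_add_norm_sub (Φ (f x)) c (f 0)
        linarith)
      have h4 := hPv (Φ (f x))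
      have h5 := norm_sub_le (P (Φ (f x)) - v) x
      have h6 := norm_sub_norm_le (P (Φ (f x)) - v) (G (Φ (f x)))
      linarith
  -- A zero off the `ε`-ball would give `‖x‖ ≤ δ / 2`, against `δ ≤ ‖x‖`; inside it, the choice of
  -- `v` is contradicted.
  rcases le_or_gt ε ‖f x - c‖ with h | h
  · simp only [hfar x hx h] at hx0
    have h1 := hPv (f x)
    rw [hx0, hGf x hx, zero_sub, norm_neg] at h1
    linarith [hδG x hx h]
  · exact hv ⟨_, hnear x hx h, sub_eq_zero.1 hx0⟩

/-- Invariance of domain for injective Lipschitz self-maps. -/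
theorem _root_.LipschitzWith.isOpenMap_of_injective {f : V → V} {K : ℝ≥0}
    (hf : LipschitzWith K f) (hinj : Function.Injective f) : IsOpenMap f := by
  refine isOpenMap_iff_nhds_le.2 fun x s hs => ?_
  obtain ⟨r, hr, hrs⟩ := Metric.nhds_basis_closedBall.mem_iff.1 (Filter.mem_map.1 hs)
  let T : V → V := fun z => x + r • z
  have hT : LocallyLipschitz T := (LocallyLipschitz.const x).add_vec
    ((LocallyLipschitz.const r).smul_vec LocallyLipschitz.id)
  have hTi : Function.Injective T := fun a b hab =>
    smul_right_injective V hr.ne' (add_left_cancel hab)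
  have h := image_closedBall_mem_nhds (hf.locallyLipschitz.comp hT) (hinj.comp hTi)
  have hT0 : T 0 = x := by simp [T]
  rw [Function.comp_apply, hT0] at h
  refine Filter.mem_of_superset h ?_
  rintro _ ⟨z, hz, rfl⟩
  refine hrs ?_
  rw [mem_closedBall_zero_iff] at hz
  rw [mem_closedBall_iff_norm]
  simp only [T, add_sub_cancel_left, norm_smul, Real.norm_of_nonneg hr.le]
  nlinarith

end

end Dissection

namespace Dissection

/-! ### The operator Φ and the attractor -/

variable {d k : ℕ} {f : Fin k → Space d → Space d} {A B D E X : Set (Space d)}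

theorem mem_Phi {x : Space d} : x ∈ Phi f A ↔ ∃ i, ∃ a ∈ A, f i a = x := by
  simp [Phi]

theorem Phi_mono (h : A ⊆ B) : Phi f A ⊆ Phi f B :=
  iUnion_mono fun _ => image_mono h

theorem Phi_union : Phi f (A ∪ B) = Phi f A ∪ Phi f B := by
  simp only [Phi, image_union, iUnion_union_distrib]

theorem Phi_iUnion {ι : Type*} (s : ι → Set (Space d)) : Phi f (⋃ n, s n) = ⋃ n, Phi f (s n) := by
  simp only [Phi, image_iUnion]
  exact iUnion_comm _

theorem IsInsideFamily.Phi_subset (hin : IsInsideFamily f D) : Phi f D ⊆ D :=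
  iUnion_subset hin

theorem Phi_iterate_mono (h : A ⊆ B) (n : ℕ) : (Phi f)^[n] A ⊆ (Phi f)^[n] B := by
  induction n with
  | zero => exact h
  | succ n ih => simpa only [Function.iterate_succ_apply'] using Phi_mono ih

theorem Phi_iterate_antitone (h : Phi f D ⊆ D) : Antitone fun n => (Phi f)^[n] D :=
  antitone_nat_of_succ_le fun n => by
    rw [Function.iterate_succ_apply]
    exact Phi_iterate_mono h n

theorem Phi_iterate_subset (h : Phi f D ⊆ D) (n : ℕ) : (Phi f)^[n] D ⊆ D :=
  Phi_iterate_antitone h n.zero_le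

theorem IsAttractor.iterate_eq (hE : IsAttractor f E) (n : ℕ) : (Phi f)^[n] E = E :=
  Function.iterate_fixed hE.eq_Phi.symm n

theorem IsIFS.lipschitz (hf : IsIFS f) (i : Fin k) : ∃ K, LipschitzWith K (f i) :=
  (hf i).imp fun _ h => h.2

theorem IsIFS.continuous (hf : IsIFS f) (i : Fin k) : Continuous (f i) :=
  (hf.lipschitz i).choose_spec.continuous

theorem IsIFS.isOpenMap (hf : IsIFS f) (hinj : ∀ i, Function.Injective (f i)) (i : Fin k) :
    IsOpenMap (f i) :=
  (hf.lipschitz i).choose_spec.isOpenMap_of_injective (hinj i)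

theorem IsIFS.volume_image_eq_zero (hf : IsIFS f) (i : Fin k) (hA : volume A = 0) :
    volume (f i '' A) = 0 :=
  ((hf.lipschitz i).choose_spec.lipschitzOnWith (s := A)).volume_image_eq_zero hA

theorem IsIFS.isCompact_Phi (hf : IsIFS f) (hA : IsCompact A) : IsCompact (Phi f A) :=
  isCompact_iUnion fun i => hA.image (hf.continuous i)

theorem IsIFS.isCompact_Phi_iterate (hf : IsIFS f) (hA : IsCompact A) (n : ℕ) :
    IsCompact ((Phi f)^[n] A) := by
  induction n with
  | zero => exact hA
  | succ n ih => simpa only [Function.iterate_succ_apply'] using hf.isCompact_Phi ih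

/-- The iterates of bounded sets under `Φ` approach each other. -/
theorem IsIFS.exists_dist_lt (hf : IsIFS f) (hA : Bornology.IsBounded A)
    (hB : Bornology.IsBounded B) (hBne : B.Nonempty) {ε : ℝ} (hε : 0 < ε) :
    ∃ N, ∀ n, N ≤ n → ∀ x ∈ (Phi f)^[n] A, ∃ y ∈ (Phi f)^[n] B, dist x y < ε := by
  choose c hc using hf
  obtain ⟨b, hb⟩ := hBne
  obtain ⟨R, hR⟩ := Metric.isBounded_iff.1 (hA.union hB)
  obtain ⟨q, hq1, hq⟩ : ∃ q : ℝ≥0, q < 1 ∧ ∀ i, c i ≤ q := by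
    refine ⟨Finset.univ.sup c, (Finset.sup_lt_iff zero_lt_one).2 fun i _ => (hc i).1, fun i =>
      Finset.le_sup (Finset.mem_univ i)⟩
  have key : ∀ n, ∀ x ∈ (Phi f)^[n] A, ∃ y ∈ (Phi f)^[n] B, dist x y ≤ (q : ℝ) ^ n * R := by
    intro n
    induction n with
    | zero =>
      intro x hx
      exact ⟨b, hb, by simpa using hR (Or.inl hx) (Or.inr hb)⟩
    | succ n ih =>
      intro x hx
      rw [Function.iterate_succ_apply', mem_Phi] at hx
      obtain ⟨i, a, ha, rfl⟩ := hx
      obtain ⟨y, hy, hay⟩ := ih a ha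
      refine ⟨f i y, ?_, ?_⟩
      · rw [Function.iterate_succ_apply', mem_Phi]
        exact ⟨i, y, hy, rfl⟩
      · calc dist (f i a) (f i y) ≤ c i * dist a y := (hc i).2.dist_le_mul a y
          _ ≤ q * (q ^ n * R) := by
            gcongr
            exact hq i
          _ = q ^ (n + 1) * R := by ring
  have hlim : Filter.Tendsto (fun n : ℕ => (q : ℝ) ^ n * R) Filter.atTop (nhds 0) := by
    simpa using (tendsto_pow_atTop_nhds_zero_of_lt_one q.2 (by exact_mod_cast hq1)).mul_const R
  obtain ⟨N, hN⟩ := Filter.eventually_atTop.1 (hlim.eventually_lt_const hε)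
  refine ⟨N, fun n hn x hx => ?_⟩
  obtain ⟨y, hy, hxy⟩ := key n x hx
  exact ⟨y, hy, hxy.trans_lt (hN n hn)⟩

theorem IsAttractor.subset_closure_iUnion (hE : IsAttractor f E) (hf : IsIFS f)
    (hA : Bornology.IsBounded A) (hne : A.Nonempty) :
    E ⊆ closure (⋃ n : ℕ, (Phi f)^[2 * n] A) := by
  intro e he
  refine Metric.mem_closure_iff.2 fun ε hε => ?_
  obtain ⟨N, hN⟩ := hf.exists_dist_lt hE.isCompact.isBounded hA hne hε
  obtain ⟨y, hy, hey⟩ := hN (2 * N) (by omega) e (by rwa [hE.iterate_eq])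
  exact ⟨y, mem_iUnion.2 ⟨N, hy⟩, hey⟩

theorem IsAttractor.mem_of_forall_mem_iterate (hE : IsAttractor f E) (hf : IsIFS f)
    (hD : Bornology.IsBounded D) {x : Space d} (hx : ∀ n : ℕ, x ∈ (Phi f)^[2 * n] D) : x ∈ E := by
  rw [← hE.isCompact.isClosed.closure_eq]
  refine Metric.mem_closure_iff.2 fun ε hε => ?_
  obtain ⟨N, hN⟩ := hf.exists_dist_lt hD hE.isCompact.isBounded hE.nonempty hε
  obtain ⟨y, hy, hxy⟩ := hN (2 * N) (by omega) x (hx N)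
  exact ⟨y, by rwa [hE.iterate_eq] at hy, hxy⟩

/-- Stated for Φ² because a generator is stable under Φ² only. The even iterates of `A` stay in `A`
and approach `E`. -/
theorem IsAttractor.subset_of_Phi_Phi_subset (hE : IsAttractor f E) (hf : IsIFS f)
    (hA : IsCompact A) (hne : A.Nonempty) (h : Phi f (Phi f A) ⊆ A) : E ⊆ A := by
  have hiter : ∀ n : ℕ, (Phi f)^[2 * n] A ⊆ A := by
    intro n
    induction n with
    | zero => exact subset_rfl
    | succ n ih =>
      rw [mul_add, mul_one, Function.iterate_succ_apply', Function.iterate_succ_apply']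
      exact (Phi_mono (Phi_mono ih)).trans h
  refine (hE.subset_closure_iUnion hf hA.isBounded hne).trans ?_
  exact closure_minimal (iUnion_subset hiter) hA.isClosed

/-- Diagonal terms are `f i '' (A ∩ B)` by injectivity, null by the Lipschitz bound; the others are
null by non-overlap. -/
theorem volume_Phi_inter_Phi_eq_zero (hf : IsIFS f) (hinj : ∀ i, Function.Injective (f i))
    (hnon : IsNonOverlappingFamily f D) (hA : A ⊆ D) (hB : B ⊆ D) (h : volume (A ∩ B) = 0) :
    volume (Phi f A ∩ Phi f B) = 0 := by
  have hsub : Phi f A ∩ Phi f B ⊆ ⋃ i, ⋃ j, (f i '' A ∩ f j '' B) := by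
    rintro x ⟨hxA, hxB⟩
    obtain ⟨i, hi⟩ := mem_iUnion.1 hxA
    obtain ⟨j, hj⟩ := mem_iUnion.1 hxB
    exact mem_iUnion₂.2 ⟨i, j, hi, hj⟩
  refine measure_mono_null hsub (measure_iUnion_null fun i => measure_iUnion_null fun j => ?_)
  rcases eq_or_ne i j with rfl | hij
  · rw [← image_inter (hinj i)]
    exact hf.volume_image_eq_zero i h
  · exact measure_mono_null (inter_subset_inter (image_mono hA) (image_mono hB)) (hnon i j hij)

/-- Invariance of domain makes `f i '' interior A` open. -/
theorem Phi_subset_closure_interior (hf : IsIFS f) (hinj : ∀ i, Function.Injective (f i))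
    (hA : A ⊆ closure (interior A)) : Phi f A ⊆ closure (interior (Phi f A)) := by
  refine iUnion_subset fun i => ?_
  calc f i '' A ⊆ f i '' closure (interior A) := image_mono hA
    _ ⊆ closure (f i '' interior A) := image_closure_subset_closure_image (hf.continuous i)
    _ ⊆ closure (interior (Phi f A)) := closure_mono <|
        interior_maximal ((image_mono interior_subset).trans (subset_iUnion (fun i => f i '' A) i))
          (hf.isOpenMap hinj i _ isOpen_interior)

theorem Phi_iterate_subset_closure_interior (hf : IsIFS f) (hinj : ∀ i, Function.Injective (f i))
    (hA : A ⊆ closure (interior A)) (n : ℕ) :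
    (Phi f)^[n] A ⊆ closure (interior ((Phi f)^[n] A)) := by
  induction n with
  | zero => exact hA
  | succ n ih =>
    simpa only [Function.iterate_succ_apply'] using Phi_subset_closure_interior hf hinj ih

/-! ### The explicit set is a generator -/

section Explicit

theorem closure_diff_Phi_subset (hD : IsCompact D) : closure (D \ Phi f D) ⊆ D :=
  closure_minimal sdiff_subset hD.isClosed

theorem closure_diff_Phi_subset_closure_interior (hf : IsIFS f) (hD : IsCompact D)
    (hDreg : closure (interior D) = D) :
    closure (D \ Phi f D) ⊆ closure (interior (closure (D \ Phi f D))) := by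
  have hcl := (hf.isCompact_Phi hD).isClosed
  refine closure_minimal (fun x hx => ?_) isClosed_closure
  refine mem_closure_iff.2 fun O hO hxO => ?_
  have hx' : x ∈ closure (interior D) := hDreg.symm ▸ hx.1
  obtain ⟨y, ⟨hyO, hyP⟩, hyD⟩ := mem_closure_iff.1 hx' (O ∩ (Phi f D)ᶜ) (hO.inter hcl.isOpen_compl)
    ⟨hxO, hx.2⟩
  refine ⟨y, hyO, ?_⟩
  have hopen : IsOpen (interior D ∩ (Phi f D)ᶜ) := isOpen_interior.inter hcl.isOpen_compl
  have hsub : interior D ∩ (Phi f D)ᶜ ⊆ closure (D \ Phi f D) := fun z hz =>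
    subset_closure ⟨interior_subset hz.1, hz.2⟩
  exact interior_maximal hsub hopen ⟨hyD, hyP⟩

/-- Each `f i '' interior D` is an open subset of Φ(D), so it misses the closure of D \ Φ(D); only
images of the frontier remain. -/
theorem volume_closure_diff_Phi_inter (hf : IsIFS f) (hinj : ∀ i, Function.Injective (f i))
    (hDfr : volume (frontier D) = 0) : volume (closure (D \ Phi f D) ∩ Phi f D) = 0 := by
  refine measure_mono_null (t := ⋃ i, f i '' frontier D) ?_
    (measure_iUnion_null fun i => hf.volume_image_eq_zero i hDfr)
  rintro x ⟨hxY, hxP⟩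
  obtain ⟨i, y, hy, rfl⟩ := mem_Phi.1 hxP
  refine mem_iUnion.2 ⟨i, y, ⟨subset_closure hy, fun hyi => ?_⟩, rfl⟩
  obtain ⟨z, ⟨w, hw, rfl⟩, -, hz⟩ := mem_closure_iff.1 hxY _
    (hf.isOpenMap hinj i _ isOpen_interior) (mem_image_of_mem _ hyi)
  exact hz (mem_Phi.2 ⟨i, w, interior_subset hw, rfl⟩)

theorem volume_iterate_inter_iterate_succ (hf : IsIFS f) (hinj : ∀ i, Function.Injective (f i))
    (hD : IsCompact D) (hDfr : volume (frontier D) = 0) (hnon : IsNonOverlappingFamily f D)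
    (hin : IsInsideFamily f D) (n : ℕ) :
    volume ((Phi f)^[n] (closure (D \ Phi f D)) ∩ (Phi f)^[n + 1] D) = 0 := by
  induction n with
  | zero => exact volume_closure_diff_Phi_inter hf hinj hDfr
  | succ n ih =>
    rw [Function.iterate_succ_apply', Function.iterate_succ_apply' _ (n + 1)]
    refine volume_Phi_inter_Phi_eq_zero hf hinj hnon ?_ (Phi_iterate_subset hin.Phi_subset _) ih
    exact (Phi_iterate_mono (closure_diff_Phi_subset hD) n).trans
      (Phi_iterate_subset hin.Phi_subset n)

theorem isCompact_explicitGenerator (hE : IsAttractor f E) (hf : IsIFS f)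
    (hD : IsCompact D) (hED : E ⊆ D) (hin : IsInsideFamily f D) :
    IsCompact (explicitGenerator f D E) := by
  set Y := closure (D \ Phi f D) with hY
  have hYD : Y ⊆ D := closure_diff_Phi_subset hD
  have hYc : IsCompact Y := hD.of_isClosed_subset isClosed_closure hYD
  -- Closedness of the infinite union comes from cutting it at level `n` and covering the rest, with
  -- `E`, by the compact Φ²ⁿ(D).
  have heq : explicitGenerator f D E =
      ⋂ n : ℕ, ((⋃ m : Fin n, (Phi f)^[2 * (m : ℕ)] Y) ∪ (Phi f)^[2 * n] D) := by
    apply Subset.antisymm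
    · refine subset_iInter fun n => union_subset ?_ (iUnion_subset fun m => ?_)
      · exact ((hE.iterate_eq (2 * n)).ge.trans (Phi_iterate_mono hED _)).trans subset_union_right
      · rcases lt_or_ge m n with h | h
        · exact (subset_iUnion (fun m : Fin n => (Phi f)^[2 * (m : ℕ)] Y) ⟨m, h⟩).trans
            subset_union_left
        · refine ((Phi_iterate_mono hYD _).trans ?_).trans subset_union_right
          exact Phi_iterate_antitone hin.Phi_subset (by omega : 2 * n ≤ 2 * m)
    · intro x hx
      rw [mem_iInter] at hx
      by_cases h : ∃ m, x ∈ (Phi f)^[2 * m] Y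
      · exact Or.inr (mem_iUnion.2 h)
      · refine Or.inl (hE.mem_of_forall_mem_iterate hf hD.isBounded fun n => ?_)
        refine (hx n).resolve_left fun hm => ?_
        obtain ⟨m, hm⟩ := mem_iUnion.1 hm
        exact h ⟨m, hm⟩
  refine hD.of_isClosed_subset ?_ ?_
  · rw [heq]
    exact isClosed_iInter fun n => (isClosed_iUnion_of_finite fun m =>
      (hf.isCompact_Phi_iterate hYc _).isClosed).union (hf.isCompact_Phi_iterate hD _).isClosed
  · exact union_subset hED (iUnion_subset fun n =>
      (Phi_iterate_mono hYD _).trans (Phi_iterate_subset hin.Phi_subset _))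

/-- A point in every Φⁿ(D) is in `E`; any other lies in some layer Φⁿ(Y), and the parity of `n`
decides the side. -/
theorem subset_explicitGenerator_union_Phi (hE : IsAttractor f E) (hf : IsIFS f)
    (hD : IsCompact D) :
    D ⊆ explicitGenerator f D E ∪ Phi f (explicitGenerator f D E) := by
  set Y := closure (D \ Phi f D) with hY
  have hstep : ∀ n, (Phi f)^[n] D ⊆ (Phi f)^[n] Y ∪ (Phi f)^[n + 1] D := by
    intro n
    induction n with
    | zero =>
      intro x hx
      by_cases h : x ∈ Phi f D
      · exact Or.inr h
      · exact Or.inl (subset_closure ⟨hx, h⟩)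
    | succ n ih =>
      rw [Function.iterate_succ_apply', Function.iterate_succ_apply',
        Function.iterate_succ_apply' _ (n + 1), ← Phi_union]
      exact Phi_mono ih
  intro x hx
  by_cases hall : ∀ n, x ∈ (Phi f)^[n] D
  · exact Or.inl (Or.inl (hE.mem_of_forall_mem_iterate hf hD.isBounded fun n => hall _))
  · obtain ⟨n, hn⟩ : ∃ n, x ∈ (Phi f)^[n] Y := by
      by_contra! hY
      refine hall fun n => ?_
      induction n with
      | zero => exact hx
      | succ n ih => exact (hstep n ih).resolve_left (hY n)
    rcases Nat.even_or_odd' n with ⟨m, rfl | rfl⟩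
    · exact Or.inl (Or.inr (mem_iUnion.2 ⟨m, hn⟩))
    · right
      rw [Function.iterate_succ_apply'] at hn
      exact Phi_mono ((subset_iUnion (fun n : ℕ => (Phi f)^[2 * n] Y) m).trans
        subset_union_right) hn

/-- Off `E`, a common point lies in an even and an odd layer. For indices a < b the later layer is
inside Φᵃ⁺¹(D), which meets Φᵃ(Y) in a null set. -/
theorem volume_explicitGenerator_inter_Phi (hE : IsAttractor f E) (hf : IsIFS f)
    (hinj : ∀ i, Function.Injective (f i)) (hD : IsCompact D) (hDfr : volume (frontier D) = 0)
    (hnon : IsNonOverlappingFamily f D) (hin : IsInsideFamily f D) (hE0 : volume E = 0) :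
    volume (explicitGenerator f D E ∩ Phi f (explicitGenerator f D E)) = 0 := by
  set Y := closure (D \ Phi f D) with hY
  have hYD : Y ⊆ D := closure_diff_Phi_subset hD
  have hsub : explicitGenerator f D E ∩ Phi f (explicitGenerator f D E) ⊆
      E ∪ ⋃ n : ℕ, ((Phi f)^[n] Y ∩ (Phi f)^[n + 1] D) := by
    have key : ∀ a b, a < b → (Phi f)^[a] Y ∩ (Phi f)^[b] Y ⊆
        ⋃ n : ℕ, ((Phi f)^[n] Y ∩ (Phi f)^[n + 1] D) := fun a b hab x hx =>
      mem_iUnion.2 ⟨a, hx.1, Phi_iterate_antitone hin.Phi_subset hab (Phi_iterate_mono hYD b hx.2)⟩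
    rintro x ⟨hx1 | hx1, hx2⟩
    · exact Or.inl hx1
    · rw [explicitGenerator, Phi_union, ← hE.eq_Phi, Phi_iUnion] at hx2
      rcases hx2 with hx2 | hx2
      · exact Or.inl hx2
      · right
        obtain ⟨m, hm⟩ := mem_iUnion.1 hx1
        obtain ⟨n, hn⟩ := mem_iUnion.1 hx2
        rw [← Function.iterate_succ_apply' (Phi f)] at hn
        rcases lt_or_gt_of_ne (by omega : 2 * m ≠ 2 * n + 1) with h | h
        · exact key _ _ h ⟨hm, hn⟩
        · exact key _ _ h ⟨hn, hm⟩
  exact measure_mono_null hsub (measure_union_null hE0 (measure_iUnion_null fun n =>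
    volume_iterate_inter_iterate_succ hf hinj hD hDfr hnon hin n))

/-- If the attractor is null then the explicit set is a generator. -/
theorem isGenerator_explicitGenerator (hE : IsAttractor f E) (hf : IsIFS f)
    (hinj : ∀ i, Function.Injective (f i)) (hDne : D.Nonempty) (hD : IsCompact D)
    (hDreg : closure (interior D) = D) (hDfr : volume (frontier D) = 0)
    (hnon : IsNonOverlappingFamily f D) (hin : IsInsideFamily f D) (hE0 : volume E = 0) :
    IsGenerator f D (explicitGenerator f D E) := by
  set Y := closure (D \ Phi f D) with hY
  have hYD : Y ⊆ D := closure_diff_Phi_subset hD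
  have hED : E ⊆ D := hE.subset_of_Phi_Phi_subset hf hD hDne
    ((Phi_mono hin.Phi_subset).trans hin.Phi_subset)
  have hc := isCompact_explicitGenerator hE hf hD hED hin
  have hSD : explicitGenerator f D E ⊆ D := union_subset hED (iUnion_subset fun n =>
    (Phi_iterate_mono hYD _).trans (Phi_iterate_subset hin.Phi_subset _))
  -- Otherwise D = Φ(D) ⊆ E would be null. A nonempty `Y` is what lets the layers accumulate on all
  -- of `E`.
  have hYne : Y.Nonempty := by
    by_contra! hempty
    have hDP : D ⊆ Phi f D := sdiff_eq_empty.1 (closure_empty_iff _ |>.1 hempty)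
    have hiter : ∀ n, (Phi f)^[n] D = D :=
      Function.iterate_fixed (hin.Phi_subset.antisymm hDP)
    have hDE : D ⊆ E := fun x hx =>
      hE.mem_of_forall_mem_iterate hf hD.isBounded fun n => by rwa [hiter]
    have hint : interior D = ∅ := isOpen_interior.measure_eq_zero_iff volume |>.1
      (measure_mono_null (interior_subset.trans hDE) hE0)
    rw [hint, closure_empty] at hDreg
    exact hDne.ne_empty hDreg.symm
  have hnull := volume_explicitGenerator_inter_Phi hE hf hinj hD hDfr hnon hin hE0
  refine ⟨hc, ?_, ?_, fun i j hij => ?_, fun i => ?_⟩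
  · refine (closure_minimal interior_subset hc.isClosed).antisymm ?_
    have hU : (⋃ n : ℕ, (Phi f)^[2 * n] Y) ⊆ closure (interior (explicitGenerator f D E)) :=
      iUnion_subset fun n =>
        (Phi_iterate_subset_closure_interior hf hinj
          (closure_diff_Phi_subset_closure_interior hf hD hDreg) (2 * n)).trans
        (closure_mono (interior_mono
          ((subset_iUnion (fun n : ℕ => (Phi f)^[2 * n] Y) n).trans subset_union_right)))
    exact union_subset ((hE.subset_closure_iUnion hf (hD.isBounded.subset hYD) hYne).trans
      (closure_minimal hU isClosed_closure)) hU
  · exact (subset_explicitGenerator_union_Phi hE hf hD).antisymm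
      (union_subset hSD ((Phi_mono hSD).trans hin.Phi_subset))
  · exact measure_mono_null (inter_subset_inter (image_mono hSD) (image_mono hSD)) (hnon i j hij)
  · exact measure_mono_null (inter_subset_inter_right _
      (subset_iUnion (fun i => f i '' explicitGenerator f D E) i)) hnull

end Explicit

/-! ### Properties of an arbitrary generator -/

namespace IsGenerator

theorem subset (hX : IsGenerator f D X) : X ⊆ D :=
  subset_union_left.trans hX.eq_union.ge

theorem Phi_subset (hX : IsGenerator f D X) : Phi f X ⊆ D :=
  subset_union_right.trans hX.eq_union.ge

theorem volume_inter_Phi (hX : IsGenerator f D X) : volume (X ∩ Phi f X) = 0 := by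
  rw [Phi, inter_iUnion]
  exact measure_iUnion_null hX.disjoint_image

theorem Phi_Phi_subset (hX : IsGenerator f D X) (hf : IsIFS f)
    (hinj : ∀ i, Function.Injective (f i)) (hnon : IsNonOverlappingFamily f D)
    (hin : IsInsideFamily f D) : Phi f (Phi f X) ⊆ X := by
  have hnull : volume (Phi f X ∩ Phi f (Phi f X)) = 0 :=
    volume_Phi_inter_Phi_eq_zero hf hinj hnon hX.subset hX.Phi_subset hX.volume_inter_Phi
  have hreg : Phi f (Phi f X) ⊆ closure (interior (Phi f (Phi f X))) :=
    Phi_subset_closure_interior hf hinj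
      (Phi_subset_closure_interior hf hinj hX.closure_interior.ge)
  intro z hz
  rw [← hX.isCompact.isClosed.closure_eq]
  refine mem_closure_iff.2 fun O hO hzO => ?_
  -- If `O` missed `X`, this nonempty open set would lie in Φ(X) ∩ Φ²(X), which is null.
  have hne : (O ∩ interior (Phi f (Phi f X))).Nonempty := mem_closure_iff.1 (hreg hz) O hO hzO
  by_contra hcon
  refine ((hO.inter isOpen_interior).measure_pos volume hne).ne' (measure_mono_null ?_ hnull)
  rintro x ⟨hxO, hxi⟩
  have hxP : x ∈ Phi f (Phi f X) := interior_subset hxi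
  have hxD : x ∈ X ∪ Phi f X :=
    hX.eq_union.le (hin.Phi_subset (Phi_mono hX.Phi_subset hxP))
  exact ⟨hxD.resolve_left fun hxX => hcon ⟨x, hxO, hxX⟩, hxP⟩

theorem nonempty (hX : IsGenerator f D X) (hDne : D.Nonempty) : X.Nonempty := by
  by_contra! h
  have := hX.eq_union
  rw [h, Phi] at this
  simp only [image_empty, iUnion_empty, union_self] at this
  exact hDne.ne_empty this

theorem attractor_subset (hX : IsGenerator f D X) (hE : IsAttractor f E) (hf : IsIFS f)
    (hinj : ∀ i, Function.Injective (f i)) (hDne : D.Nonempty)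
    (hnon : IsNonOverlappingFamily f D) (hin : IsInsideFamily f D) : E ⊆ X :=
  hE.subset_of_Phi_Phi_subset hf hX.isCompact (hX.nonempty hDne)
    (hX.Phi_Phi_subset hf hinj hnon hin)

theorem volume_attractor (hX : IsGenerator f D X) (hE : IsAttractor f E) (hf : IsIFS f)
    (hinj : ∀ i, Function.Injective (f i)) (hDne : D.Nonempty)
    (hnon : IsNonOverlappingFamily f D) (hin : IsInsideFamily f D) : volume E = 0 := by
  have h := hX.attractor_subset hE hf hinj hDne hnon hin
  exact measure_mono_null (subset_inter h (hE.eq_Phi.le.trans (Phi_mono h))) hX.volume_inter_Phi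

theorem eq_explicitGenerator (hX : IsGenerator f D X) (hE : IsAttractor f E) (hf : IsIFS f)
    (hinj : ∀ i, Function.Injective (f i)) (hDne : D.Nonempty) (hD : IsCompact D)
    (hnon : IsNonOverlappingFamily f D) (hin : IsInsideFamily f D) :
    X = explicitGenerator f D E := by
  have hEX := hX.attractor_subset hE hf hinj hDne hnon hin
  have hPP := hX.Phi_Phi_subset hf hinj hnon hin
  have hYX : closure (D \ Phi f D) ⊆ X := by
    refine closure_minimal (fun x hx => ?_) hX.isCompact.isClosed
    exact (hX.eq_union.le hx.1).resolve_right fun h => hx.2 (Phi_mono hX.subset h)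
  have hSX : explicitGenerator f D E ⊆ X := by
    refine union_subset hEX (iUnion_subset fun n => ?_)
    induction n with
    | zero => exact hYX
    | succ n ih =>
      rw [mul_add, mul_one, Function.iterate_succ_apply', Function.iterate_succ_apply']
      exact (Phi_mono (Phi_mono ih)).trans hPP
  have hcl : IsClosed (explicitGenerator f D E) :=
    (isCompact_explicitGenerator hE hf hD (hEX.trans hX.subset) hin).isClosed
  refine Subset.antisymm ?_ hSX
  -- A point of `X` outside the explicit set S lies in Φ(S) ⊆ Φ(X), so this open set is null.
  have hempty : interior X ∩ (explicitGenerator f D E)ᶜ = ∅ := by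
    refine ((isOpen_interior.inter hcl.isOpen_compl).measure_eq_zero_iff volume).1
      (measure_mono_null (fun x hx => ?_) hX.volume_inter_Phi)
    have hxX := interior_subset hx.1
    exact ⟨hxX, Phi_mono hSX
      ((subset_explicitGenerator_union_Phi hE hf hD (hX.subset hxX)).resolve_left hx.2)⟩
  calc X = closure (interior X) := hX.closure_interior.symm
    _ ⊆ explicitGenerator f D E := closure_minimal (fun x hx => by
        by_contra h
        exact hempty.le ⟨hx, h⟩) hcl

end IsGenerator

end Dissection

theorem mainTheorem2 {d k : ℕ}
    (D : Set (Dissection.Space d)) (hDne : D.Nonempty) (hD : IsCompact D)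
    (hDreg : closure (interior D) = D) (hDfr : volume (frontier D) = 0)
    (f : Fin k → Dissection.Space d → Dissection.Space d)
    (hinj : ∀ i, Function.Injective (f i)) (hifs : Dissection.IsIFS f)
    (E : Set (Dissection.Space d)) (hE : Dissection.IsAttractor f E)
    (hnon : Dissection.IsNonOverlappingFamily f D) (hin : Dissection.IsInsideFamily f D) :
    (Dissection.AdmitsDissection f D ↔ volume E = 0) ∧
    (Dissection.AdmitsDissection f D →
      (∃! X, Dissection.IsGenerator f D X) ∧
      ∀ X, Dissection.IsGenerator f D X ↔ X = Dissection.explicitGenerator f D E) := by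
  have hex := Dissection.isGenerator_explicitGenerator hE hifs hinj hDne hD hDreg hDfr hnon hin
  have heq : ∀ X, Dissection.IsGenerator f D X → X = Dissection.explicitGenerator f D E :=
    fun X hX => hX.eq_explicitGenerator hE hifs hinj hDne hD hnon hin
  have hnull : Dissection.AdmitsDissection f D → volume E = 0 := fun ⟨X, hX⟩ =>
    hX.volume_attractor hE hifs hinj hDne hnon hin
  refine ⟨⟨hnull, fun h => ⟨_, hex h⟩⟩, fun h => ?_⟩
  have hgen := hex (hnull h)
  exact ⟨⟨_, hgen, heq⟩, fun X => ⟨heq X, fun hX => hX ▸ hgen⟩⟩
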